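/- Let $F$ be a field of characteristic zero, let $0 \le k < n$ be integers, and let $\Phi : M_n(F) \to M_k(F)$ be a multiplicative map, that is, a map (not assumed additive) with $\Phi(AB) = \Phi(A)\Phi(B)$ for all $A, B \in M_n(F)$. If $\Phi(I_n) = I_k$, then $\Phi$ is trivial, meaning that $\Phi(A) = I_k$ for every $A \in SL(n,F)$. Moreover, whether or not $\Phi(I_n) = I_k$, the map $\Phi$ factors through the determinant: there is a multiplicative map $\overline{\Phi} : F \to M_k(F)$ (that is, $\overline{\Phi}(ab) = \overline{\Phi}(a)\overline{\Phi}(b)$ for all $a, b \in F$) such that $\Phi(A) = \overline{\Phi}(\det A)$ for all $A \in M_n(F)$. -/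

import Mathlib

/-- A multiplicative map `Φ : M_n(F) → M_k(F)` is trivial if `SL(n, F) ⊆ Φ⁻¹(I_k)`. -/
def IsTrivialMulMap {F : Type*} [Field F] {n k : ℕ}
    (Φ : Matrix (Fin n) (Fin n) F →ₙ* Matrix (Fin k) (Fin k) F) : Prop :=
  {A : Matrix (Fin n) (Fin n) F | A.det = 1} ⊆ Φ ⁻¹' {1}

/-! Everything reduces to showing that transvections go to `Φ 1`: they and diagonal matrices
generate the monoid, and signed swaps gather diagonal entries in one slot, so only the determinant
survives. Extend scalars to the algebraic closure, restrict to the range of `Φ 1`, and induct on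
matrix size. Up to dimension one the operators commute, and transvections are commutators. In higher
dimension, the last-row unipotents commute and each is conjugate to all its positive powers, so
their only eigenvalue is 1 and their common fixed space `W` is nonzero. If `W` is everything,
commutators spread triviality. Otherwise induction trivializes the block SL on `W` and on `V ⧸ W`;
its operators then commute, so block transvections die, and with them all the others. -/

section

open Matrix

/-! ### Transvections and the determinant -/

/-- A homomorphism whose values on matrices of determinant one commute is trivial on transvections,
since every transvection is a commutator of matrices of determinant one. -/
theorem Matrix.map_transvection_eq_one_of_commute {ι F M : Type*} [Fintype ι] [DecidableEq ι]
    [Field F] [CharZero F] [Monoid M] (f : Matrix ι ι F →* M)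
    (hf : ∀ A B : Matrix ι ι F, A.det = 1 → B.det = 1 → Commute (f A) (f B))
    {i j : ι} (hij : i ≠ j) (c : F) : f (transvection i j c) = 1 := by
  -- Conjugation by `diagonal D` multiplies the `(i, j)` entry by 4, and 4c/3 = c + c/3.
  set D : ι → F := Pi.mulSingle i 2 * Pi.mulSingle j 2⁻¹ with hD
  have hDi : D i = 2 := by simp [hD, Pi.mulSingle_eq_of_ne hij]
  have hDj : D j = 2⁻¹ := by simp [hD, Pi.mulSingle_eq_of_ne hij.symm]
  have hdet : (diagonal D).det = 1 := by
    simp [det_diagonal, hD, Finset.prod_mul_distrib, Finset.prod_pi_mulSingle']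
  have hrel : diagonal D * transvection i j (c / 3) =
      transvection i j c * (transvection i j (c / 3) * diagonal D) := by
    rw [← mul_assoc, transvection_mul_transvection_same i j hij]
    have hl : diagonal D * single i j (c / 3) = single i j (2 * (c / 3)) := by
      ext a b
      by_cases ha : i = a
      · simp [← ha, hDi, single_apply]
      · simp [ha]
    have hr : single i j (c + c / 3) * diagonal D = single i j ((c + c / 3) * 2⁻¹) := by
      ext a b
      by_cases hb : j = b
      · simp [← hb, hDj, single_apply, ite_mul]
      · simp [hb]
    rw [transvection, transvection, mul_add, add_mul, mul_one, one_mul, hl, hr]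
    congr 2
    field_simp
    ring
  have hu : ∀ A : Matrix ι ι F, A.det = 1 → IsUnit (f A) := fun A hA =>
    ((isUnit_iff_isUnit_det A).2 (by simp [hA])).map f
  have h1 := congrArg f hrel
  have ht := det_transvection_of_ne i j hij (c / 3)
  rw [map_mul, map_mul, map_mul, (hf _ _ hdet ht).eq] at h1
  have hu2 := (hu _ ht).mul (hu _ hdet)
  exact (hu2.mul_right_cancel ((one_mul _).trans h1)).symm

theorem Matrix.map_transvection_eq_one_of_commutator {ι F M : Type*} [Fintype ι] [DecidableEq ι]
    [Field F] [Monoid M] (f : Matrix ι ι F →* M) {i j l : ι} (hij : i ≠ j) (hil : i ≠ l)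
    (hlj : l ≠ j) (c : F)
    (h : f (transvection i l c) = 1 ∨ f (transvection l j 1) = 1) :
    f (transvection i j c) = 1 := by
  have hrel : transvection i l c * transvection l j 1 =
      transvection i j c * (transvection l j 1 * transvection i l c) := by
    simp only [transvection, mul_add, add_mul, mul_one, one_mul, single_mul_single_same,
      single_mul_single_of_ne _ _ _ _ hij.symm, single_mul_single_of_ne _ _ _ _ hlj.symm,
      add_zero]
    abel
  have hu : ∀ (a b : ι) (c : F), a ≠ b → IsUnit (f (transvection a b c)) := fun a b c hab =>
    ((isUnit_iff_isUnit_det _).2 (by simp [det_transvection_of_ne a b hab c])).map f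
  have h1 := congrArg f hrel
  simp only [map_mul] at h1
  rcases h with h | h
  · rw [h, one_mul, mul_one] at h1
    exact ((hu l j 1 hlj).mul_right_cancel ((one_mul _).trans h1)).symm
  · rw [h, one_mul, mul_one] at h1
    exact ((hu i l c hil).mul_right_cancel ((one_mul _).trans h1)).symm

/-- The product of three transvections acting as a signed swap moves a diagonal entry. -/
theorem Matrix.signedSwap_mul_diagonal_mulSingle {ι F : Type*} [Fintype ι] [DecidableEq ι]
    [Field F] {i j : ι} (hij : i ≠ j) (a : F) :
    (transvection i j 1 * transvection j i (-1) * transvection i j 1) *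
        diagonal (Pi.mulSingle i a) =
      diagonal (Pi.mulSingle j a) *
        (transvection i j 1 * transvection j i (-1) * transvection i j 1) := by
  have hm : ∀ (l : ι), (diagonal (Pi.mulSingle l a) : Matrix ι ι F) = 1 + single l l (a - 1) := by
    intro l
    ext x y
    by_cases hxy : x = y
    · subst hxy
      by_cases hx : x = l
      · subst hx; simp
      · simp [hx, Ne.symm hx]
    · by_cases hx : l = x
      · subst hx; simp [hxy]
      · simp [hxy, hx]
  have hsw : (transvection i j 1 * transvection j i (-1) * transvection i j 1 : Matrix ι ι F) =
      1 - single i i 1 - single j j 1 + single i j 1 - single j i 1 := by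
    simp [transvection, mul_add, add_mul, single_mul_single_of_ne _ _ _ _ hij.symm,
      ← single_neg]
    abel
  rw [hsw, hm, hm]
  simp [mul_add, add_mul, sub_mul, mul_sub, single_mul_single_of_ne _ _ _ _ hij.symm]
  abel

theorem Matrix.map_eq_map_diagonal_det {ι F M : Type*} [Fintype ι] [DecidableEq ι]
    [Field F] [Semigroup M] (f : Matrix ι ι F →ₙ* M)
    (hf : ∀ t : TransvectionStruct ι F, f t.toMatrix = f 1) (i₀ : ι) (A : Matrix ι ι F) :
    f A = f (diagonal (Pi.mulSingle i₀ A.det)) := by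
  have hl : ∀ A, f 1 * f A = f A := fun A => by rw [← map_mul, one_mul]
  have hr : ∀ A, f A * f 1 = f A := fun A => by rw [← map_mul, mul_one]
  have hft : ∀ (i j : ι) (c : F), i ≠ j → f (transvection i j c) = f 1 := fun i j c hij =>
    hf ⟨i, j, hij, c⟩
  have hmove : ∀ i a, f (diagonal (Pi.mulSingle i a)) = f (diagonal (Pi.mulSingle i₀ a)) := by
    intro i a
    by_cases hi : i = i₀
    · rw [hi]
    have h := congrArg f (signedSwap_mul_diagonal_mulSingle hi a)
    simpa only [map_mul, hft _ _ _ hi, hft _ _ _ (Ne.symm hi), hl, hr] using h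
  have hdm : ∀ D E : ι → F, f (diagonal (D * E)) = f (diagonal D) * f (diagonal E) := by
    intro D E
    rw [← map_mul, diagonal_mul_diagonal]; rfl
  have hdiag : ∀ (D : ι → F) (s : Finset ι),
      f (diagonal (∏ i ∈ s, Pi.mulSingle i (D i))) =
        f (diagonal (Pi.mulSingle i₀ (∏ i ∈ s, D i))) := by
    intro D s
    induction s using Finset.induction_on with
    | empty => simp
    | insert i s hi ih =>
      rw [Finset.prod_insert hi, Finset.prod_insert hi, hdm, ih, hmove, ← hdm,
        ← Pi.mulSingle_mul]
  induction A using diagonal_transvection_induction with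
  | hdiag D _ => rw [det_diagonal, ← hdiag, Finset.univ_prod_mulSingle]
  | htransvec t => rw [hf, t.det, Pi.mulSingle_one, Pi.one_def, diagonal_one]
  | hmul A B hA hB => rw [map_mul, hA, hB, ← hdm, ← Pi.mulSingle_mul, det_mul]

/-! ### Eigenvalues and common fixed vectors -/

/-- By pigeonhole on powers every element is a root of unity; one common exponent then maps all of
`S` to 1, yet its image is `S`. -/
theorem Set.Finite.subset_one_of_image_pow_eq {K : Type*} [Field K] {S : Set K} (hS : S.Finite)
    (h0 : (0 : K) ∉ S) (hpow : ∀ m : ℕ, 0 < m → (· ^ m) '' S = S) : S ⊆ {1} := by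
  have hfin : ∀ s ∈ S, ∃ N : ℕ, 0 < N ∧ s ^ N = 1 := by
    intro s hs
    have hs0 : s ≠ 0 := fun h => h0 (h ▸ hs)
    have hmaps : Set.MapsTo (fun m : ℕ => s ^ (m + 1)) Set.univ S := fun m _ =>
      (hpow (m + 1) m.succ_pos).subset ⟨s, hs, rfl⟩
    obtain ⟨a, -, b, -, hab, he⟩ := Set.infinite_univ.exists_lt_map_eq_of_mapsTo hmaps hS
    refine ⟨b - a, by omega, ?_⟩
    have he' : s ^ (a + 1) * s ^ (b - a) = s ^ (a + 1) * 1 := by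
      rw [← pow_add, mul_one, show a + 1 + (b - a) = b + 1 by omega]
      exact he.symm
    exact mul_left_cancel₀ (pow_ne_zero _ hs0) he'
  choose! N hN hN1 using hfin
  intro μ hμ
  have hpos : 0 < ∏ s ∈ hS.toFinset, N s :=
    Finset.prod_pos fun s hs => hN s (hS.mem_toFinset.1 hs)
  obtain ⟨s, hs, rfl⟩ := (hpow _ hpos).symm.subset hμ
  obtain ⟨q, hq⟩ := Finset.dvd_prod_of_mem N (hS.mem_toFinset.2 hs)
  simp [hq, pow_mul, hN1 s hs]

theorem Module.End.eq_one_of_hasEigenvalue_of_conj_pow {K V : Type*} [Field K] [IsAlgClosed K]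
    [AddCommGroup V] [Module K V] [FiniteDimensional K V] (u : Module.End K V) (hu : IsUnit u)
    (h : ∀ m : ℕ, 0 < m → ∃ d : (Module.End K V)ˣ, (d : Module.End K V) * u = u ^ m * d)
    {μ : K} (hμ : Module.End.HasEigenvalue u μ) : μ = 1 := by
  refine (Module.End.finite_spectrum u).subset_one_of_image_pow_eq ?_ ?_ hμ.mem_spectrum
  · exact spectrum.zero_notMem K hu
  · intro m hm
    obtain ⟨d, hd⟩ := h m hm
    rw [← spectrum.map_pow_of_pos u hm]
    have : u ^ m = d * u * (d⁻¹ : (Module.End K V)ˣ) := by rw [hd, Units.mul_inv_cancel_right]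
    rw [this, spectrum.units_conjugate]

theorem Module.End.exists_common_fixed_vector {ι K V : Type*} [Field K] [IsAlgClosed K]
    [AddCommGroup V] [Module K V] [FiniteDimensional K V] [Nontrivial V]
    (T : ι → Module.End K V) (hT : ∀ x y, Commute (T x) (T y))
    (h1 : ∀ x μ, Module.End.HasEigenvalue (T x) μ → μ = 1) :
    ∃ v : V, v ≠ 0 ∧ ∀ x, T x v = v := by
  -- On a minimal nonzero invariant subspace, the fixed vectors of each `T x` form a nonzero
  -- invariant subspace, hence all of it.
  obtain ⟨W, ⟨hW0, hW⟩, hmin⟩ := (wellFounded_lt (α := Submodule K V)).has_min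
    {W | W ≠ ⊥ ∧ ∀ x, ∀ w ∈ W, T x w ∈ W} ⟨⊤, top_ne_bot, fun _ _ _ => trivial⟩
  obtain ⟨v, hv, hv0⟩ := W.exists_mem_ne_zero_of_ne_bot hW0
  refine ⟨v, hv0, fun x => ?_⟩
  by_contra hne
  refine hmin (W ⊓ LinearMap.ker (T x - 1)) ⟨?_, ?_⟩ ?_
  · have : Nontrivial W := Submodule.nontrivial_iff_ne_bot.2 hW0
    obtain ⟨μ, hμ⟩ := Module.End.exists_eigenvalue ((T x).restrict (hW x))
    obtain ⟨w, hw⟩ := hμ.exists_hasEigenvector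
    have hw' : T x w = μ • (w : V) := congrArg Subtype.val hw.apply_eq_smul
    have hw0 : (w : V) ≠ 0 := fun h => hw.2 (Subtype.ext h)
    have hμ1 : μ = 1 := h1 x μ (Module.End.hasEigenvalue_of_hasEigenvector
      (Module.End.hasEigenvector_iff.2 ⟨Module.End.mem_eigenspace_iff.2 hw', hw0⟩))
    rw [Submodule.ne_bot_iff]
    exact ⟨w, ⟨w.2, by simp [hw', hμ1]⟩, hw0⟩
  · rintro y w ⟨hw, hwx⟩
    refine ⟨hW y w hw, ?_⟩
    have hwx' : T x w = w := by simpa [sub_eq_zero] using hwx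
    have hc : T x (T y w) = T y (T x w) := LinearMap.congr_fun (hT x y).eq w
    simp [hc, hwx']
  · refine lt_of_le_of_ne inf_le_left fun he => hne ?_
    have : v ∈ W ⊓ LinearMap.ker (T x - 1) := he.ge hv
    simpa [sub_eq_zero] using this.2

/-! ### The upper left block and the last row -/

/-- The embedding `A ↦ diag(A, 1)` of matrix monoids. -/
def Matrix.blockOneHom (κ F : Type*) [Fintype κ] [DecidableEq κ] [Field F] :
    Matrix κ κ F →* Matrix (κ ⊕ Unit) (κ ⊕ Unit) F where
  toFun A := fromBlocks A 0 0 1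
  map_one' := fromBlocks_one
  map_mul' A B := by simp [fromBlocks_multiply]

/-- The lower block-unipotent matrix with last row `(x, 1)`. -/
def Matrix.lastRowUnipotent {κ F : Type*} [DecidableEq κ] [Field F] (x : Matrix Unit κ F) :
    Matrix (κ ⊕ Unit) (κ ⊕ Unit) F :=
  fromBlocks 1 0 x 1

section LastRow

variable {κ F : Type*} [DecidableEq κ] [Field F]

theorem Matrix.lastRowUnipotent_zero : lastRowUnipotent (0 : Matrix Unit κ F) = 1 :=
  fromBlocks_one

theorem Matrix.lastRowUnipotent_single (j : κ) (c : F) :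
    lastRowUnipotent (single () j c) = transvection (Sum.inr ()) (Sum.inl j) c := by
  ext (a | a) (b | b) <;> simp [lastRowUnipotent, transvection, single, one_apply]

variable [Fintype κ]

theorem Matrix.lastRowUnipotent_mul (x y : Matrix Unit κ F) :
    lastRowUnipotent x * lastRowUnipotent y = lastRowUnipotent (x + y) := by
  simp [lastRowUnipotent, fromBlocks_multiply]

theorem Matrix.lastRowUnipotent_pow (x : Matrix Unit κ F) (m : ℕ) :
    lastRowUnipotent x ^ m = lastRowUnipotent (m • x) := by
  induction m with
  | zero => rw [pow_zero, zero_smul, lastRowUnipotent_zero]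
  | succ m ih => rw [pow_succ, ih, lastRowUnipotent_mul, succ_nsmul]

theorem Matrix.lastRowUnipotent_mul_blockOneHom (x : Matrix Unit κ F) (B : Matrix κ κ F) :
    lastRowUnipotent x * blockOneHom κ F B = blockOneHom κ F B * lastRowUnipotent (x * B) := by
  simp [lastRowUnipotent, blockOneHom, fromBlocks_multiply]

theorem Matrix.isUnit_lastRowUnipotent (x : Matrix Unit κ F) : IsUnit (lastRowUnipotent x) := by
  rw [isUnit_iff_isUnit_det, lastRowUnipotent, det_fromBlocks_zero₁₂]
  simp

theorem Matrix.blockOneHom_transvection (i j : κ) (c : F) :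
    blockOneHom κ F (transvection i j c) = transvection (Sum.inl i) (Sum.inl j) c := by
  ext (a | a) (b | b) <;> simp [blockOneHom, transvection, single, one_apply]

theorem Matrix.exists_unit_conj_lastRowUnipotent_pow [CharZero F] (x : Matrix Unit κ F) {m : ℕ}
    (hm : 0 < m) : ∃ d : (Matrix (κ ⊕ Unit) (κ ⊕ Unit) F)ˣ,
      (d : Matrix (κ ⊕ Unit) (κ ⊕ Unit) F) * lastRowUnipotent x = lastRowUnipotent x ^ m * d := by
  -- Conjugation by diag(1, …, 1, m) scales the last row by `m`; characteristic zero makes it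
  -- invertible.
  have hu : IsUnit (fromBlocks 1 0 0 (diagonal fun _ => (m : F)) :
      Matrix (κ ⊕ Unit) (κ ⊕ Unit) F) := by
    rw [isUnit_iff_isUnit_det, det_fromBlocks_zero₁₂]
    simp [hm.ne']
  refine ⟨hu.unit, ?_⟩
  rw [lastRowUnipotent_pow, IsUnit.unit_spec]
  simp [lastRowUnipotent, fromBlocks_multiply, ← Nat.cast_smul_eq_nsmul F,
    ← smul_one_eq_diagonal]

/-- Triviality on the transvections of the upper left block spreads to all transvections. -/
theorem Matrix.map_transvection_eq_one_of_inl [Nontrivial κ] {M : Type*} [Monoid M]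
    (f : Matrix (κ ⊕ Unit) (κ ⊕ Unit) F →* M)
    (h : ∀ (i j : κ) (c : F), i ≠ j → f (transvection (Sum.inl i) (Sum.inl j) c) = 1)
    (t : TransvectionStruct (κ ⊕ Unit) F) : f t.toMatrix = 1 := by
  obtain ⟨i, j, hij, c⟩ := t
  rw [TransvectionStruct.toMatrix_mk]
  rcases i with i | i <;> rcases j with j | j
  · exact h i j c (by simpa using hij)
  · obtain ⟨l, hl⟩ := exists_ne i
    exact map_transvection_eq_one_of_commutator f hij (l := Sum.inl l) (by simpa using hl.symm)
      (by simp) c (Or.inl (h i l c hl.symm))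
  · obtain ⟨l, hl⟩ := exists_ne j
    exact map_transvection_eq_one_of_commutator f hij (l := Sum.inl l) (by simp)
      (by simpa using hl) c (Or.inr (h l j 1 hl))
  · exact absurd rfl hij

end LastRow

/-! ### Induction on the matrix size -/

/-- A representation that is trivial on an invariant subspace and on the quotient by it has
commuting operators. -/
theorem Module.End.commute_of_trivial_on_sub_and_quotient {K V : Type*} [Field K] [AddCommGroup V]
    [Module K V] (W : Submodule K V) {S T : Module.End K V}
    (hS : ∀ w ∈ W, S w = w) (hT : ∀ w ∈ W, T w = w)
    (hSq : ∀ v, S v - v ∈ W) (hTq : ∀ v, T v - v ∈ W) : Commute S T := by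
  refine LinearMap.ext fun v => ?_
  have h1 := hS _ (hTq v)
  have h2 := hT _ (hSq v)
  rw [map_sub, sub_eq_iff_eq_add] at h1 h2
  simp only [Module.End.mul_apply, h1, h2]
  abel

theorem Matrix.map_transvection_eq_one_of_block {κ F K : Type*} {V : Type*}
    [Fintype κ] [DecidableEq κ] [Nontrivial κ] [Field F] [CharZero F] [Field K] [IsAlgClosed K]
    [AddCommGroup V] [Module K V] [FiniteDimensional K V]
    (ρ : Matrix (κ ⊕ Unit) (κ ⊕ Unit) F →* Module.End K V)
    (ih : ∀ W : Submodule K V, W ≠ ⊥ → W ≠ ⊤ →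
      (∀ σ : Matrix κ κ F →* Module.End K W, ∀ A, A.det = 1 → σ A = 1) ∧
      (∀ σ : Matrix κ κ F →* Module.End K (V ⧸ W), ∀ A, A.det = 1 → σ A = 1))
    (t : TransvectionStruct (κ ⊕ Unit) F) : ρ t.toMatrix = 1 := by
  let W : Submodule K V := ⨅ x : Matrix Unit κ F, LinearMap.ker (ρ (lastRowUnipotent x) - 1)
  have hWmem : ∀ v, v ∈ W ↔ ∀ x : Matrix Unit κ F, ρ (lastRowUnipotent x) v = v := fun v => by
    simp [W, Submodule.mem_iInf, sub_eq_zero]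
  refine map_transvection_eq_one_of_inl ρ (fun i j c hij => ?_) t
  by_cases hWtop : W = ⊤
  · refine map_transvection_eq_one_of_commutator ρ (l := Sum.inr ()) (by simpa using hij)
      (by simp) (by simp) c (Or.inr ?_)
    rw [← lastRowUnipotent_single]
    exact LinearMap.ext fun v => (hWmem v).1 (hWtop ▸ Submodule.mem_top) _
  have hWbot : W ≠ ⊥ := by
    have : Nontrivial V := by
      by_contra hV
      rw [not_nontrivial_iff_subsingleton] at hV
      exact hWtop (Subsingleton.elim _ _)
    obtain ⟨v, hv0, hv⟩ := Module.End.exists_common_fixed_vector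
      (fun x : Matrix Unit κ F => ρ (lastRowUnipotent x))
      (fun x y => by
        rw [commute_iff_eq, ← map_mul, ← map_mul, lastRowUnipotent_mul, lastRowUnipotent_mul,
          add_comm])
      (fun x μ hμ => by
        refine Module.End.eq_one_of_hasEigenvalue_of_conj_pow _
          ((isUnit_lastRowUnipotent x).map ρ) (fun m hm => ?_) hμ
        obtain ⟨d, hd⟩ := exists_unit_conj_lastRowUnipotent_pow x hm
        refine ⟨Units.map (ρ : _ →* _) d, ?_⟩
        rw [Units.coe_map, ← map_mul, hd, map_mul, map_pow])
    exact (Submodule.ne_bot_iff _).2 ⟨v, (hWmem v).2 hv, hv0⟩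
  let β := ρ.comp (blockOneHom κ F)
  -- The exchange relation needs no inverse of `A`, so singular blocks preserve `W` too.
  have hβ : ∀ A, ∀ w ∈ W, β A w ∈ W := by
    intro A w hw
    rw [hWmem] at hw ⊢
    intro x
    have h := LinearMap.congr_fun (congrArg ρ (lastRowUnipotent_mul_blockOneHom x A)) w
    rw [map_mul, map_mul, Module.End.mul_apply, Module.End.mul_apply, hw] at h
    exact h
  let σ₁ : Matrix κ κ F →* Module.End K W :=
    { toFun := fun A => (β A).restrict (hβ A)
      map_one' := by ext w; simp
      map_mul' := fun A B => by ext w; simp }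
  let σ₂ : Matrix κ κ F →* Module.End K (V ⧸ W) :=
    { toFun := fun A => W.mapQ W (β A) (hβ A)
      map_one' := by ext w; simp
      map_mul' := fun A B => by ext w; simp }
  have hsub : ∀ A : Matrix κ κ F, A.det = 1 → ∀ w ∈ W, β A w = w := fun A hA w hw =>
    congrArg Subtype.val (LinearMap.congr_fun ((ih W hWbot hWtop).1 σ₁ A hA) ⟨w, hw⟩)
  have hquo : ∀ A : Matrix κ κ F, A.det = 1 → ∀ v, β A v - v ∈ W := fun A hA v =>
    (Submodule.Quotient.eq W).1 (LinearMap.congr_fun ((ih W hWbot hWtop).2 σ₂ A hA) (W.mkQ v))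
  rw [← blockOneHom_transvection]
  exact map_transvection_eq_one_of_commute β (fun A B hA hB =>
    Module.End.commute_of_trivial_on_sub_and_quotient W (hsub A hA) (hsub B hB)
      (hquo A hA) (hquo B hB)) hij c

theorem Module.End.commute_of_finrank_le_one {K V : Type*} [Field K] [AddCommGroup V] [Module K V]
    [FiniteDimensional K V] (h : Module.finrank K V ≤ 1) (S T : Module.End K V) : Commute S T := by
  obtain ⟨v, hv⟩ := finrank_le_one_iff.1 h
  refine LinearMap.ext fun w => ?_
  obtain ⟨a, ha⟩ := hv (S v)
  obtain ⟨b, hb⟩ := hv (T v)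
  obtain ⟨c, rfl⟩ := hv w
  simp [← ha, ← hb, smul_smul, mul_comm a b]

theorem Matrix.map_eq_one_of_det_eq_one {ι F M : Type*} [Fintype ι] [DecidableEq ι] [Nonempty ι]
    [Field F] [Monoid M] (f : Matrix ι ι F →* M)
    (hf : ∀ t : TransvectionStruct ι F, f t.toMatrix = 1) {A : Matrix ι ι F} (hA : A.det = 1) :
    f A = 1 := by
  have h := map_eq_map_diagonal_det (f : Matrix ι ι F →ₙ* M)
    (fun t => (hf t).trans (map_one f).symm) (Classical.arbitrary ι) A
  simpa [hA, Pi.one_def] using h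

/-- A representation of the monoid of `m × m` matrices in dimension less than `m` is trivial on
transvections. -/
theorem Matrix.map_transvection_eq_one_of_finrank_lt {F : Type*} {K : Type*} [Field F] [CharZero F]
    [Field K] [IsAlgClosed K] (m : ℕ) {V : Type*} [AddCommGroup V] [Module K V]
    [FiniteDimensional K V] (hV : Module.finrank K V < m)
    (ρ : Matrix (Fin m) (Fin m) F →* Module.End K V) (t : TransvectionStruct (Fin m) F) :
    ρ t.toMatrix = 1 := by
  induction m generalizing V with
  | zero => exact absurd hV (Nat.not_lt_zero _)
  | succ m ih =>
    rcases Nat.lt_or_ge 1 (Module.finrank K V) with h1 | h1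
    · have hm : 1 < m := by omega
      have : Nontrivial (Fin m) := Fin.nontrivial_iff_two_le.2 hm
      let e : Fin m ⊕ Unit ≃ Fin (m + 1) := Fintype.equivOfCardEq (by simp)
      let r := (reindexAlgEquiv F F e : Matrix (Fin m ⊕ Unit) (Fin m ⊕ Unit) F ≃ₐ[F] _)
      have h := map_transvection_eq_one_of_block
        (ρ.comp (r : _ →* _)) (fun W hb ht => by
          -- Both `W` and `V ⧸ W` have dimension below that of `V`, hence below `m`.
          have h2 := Submodule.finrank_lt ht
          have h3 := W.finrank_quotient_add_finrank
          have h4 := Submodule.one_le_finrank_iff.2 hb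
          exact ⟨fun σ A hA => map_eq_one_of_det_eq_one σ (ih (by omega) σ) hA,
            fun σ A hA => map_eq_one_of_det_eq_one σ (ih (by omega) σ) hA⟩)
        (t.reindexEquiv e.symm)
      have hr : r (t.reindexEquiv e.symm).toMatrix = t.toMatrix := by
        rw [TransvectionStruct.toMatrix_reindexEquiv]
        ext; simp [r]
      rw [← hr]
      exact h
    · exact map_transvection_eq_one_of_commute ρ
        (fun A B _ _ => Module.End.commute_of_finrank_le_one h1 _ _) t.hij t.c

/-- The non-unital case reduces to the unital one on the range of the idempotent `Ψ 1`. -/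
theorem Matrix.map_transvection_eq_map_one_of_finrank_lt {F K : Type*} [Field F] [CharZero F]
    [Field K] [IsAlgClosed K] {m : ℕ} {V : Type*} [AddCommGroup V] [Module K V]
    [FiniteDimensional K V] (hV : Module.finrank K V < m)
    (Ψ : Matrix (Fin m) (Fin m) F →ₙ* Module.End K V) (t : TransvectionStruct (Fin m) F) :
    Ψ t.toMatrix = Ψ 1 := by
  have hl : ∀ A v, Ψ 1 (Ψ A v) = Ψ A v := fun A v => by
    rw [← Module.End.mul_apply, ← map_mul, one_mul]
  have hW : ∀ A, ∀ w ∈ LinearMap.range (Ψ 1), Ψ A w ∈ LinearMap.range (Ψ 1) := fun A w _ =>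
    ⟨Ψ A w, hl A w⟩
  let ρ : Matrix (Fin m) (Fin m) F →* Module.End K (LinearMap.range (Ψ 1)) :=
    { toFun := fun A => (Ψ A).restrict (hW A)
      map_one' := by
        ext ⟨_, v, rfl⟩
        simp [hl]
      map_mul' := fun A B => by ext w; simp }
  have h := map_transvection_eq_one_of_finrank_lt m
    ((Submodule.finrank_le _).trans_lt hV) ρ t
  refine LinearMap.ext fun v => ?_
  have h2 : Ψ t.toMatrix (Ψ 1 v) = Ψ 1 v :=
    congrArg Subtype.val (LinearMap.congr_fun h ⟨Ψ 1 v, v, rfl⟩)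
  rwa [← Module.End.mul_apply, ← map_mul, mul_one] at h2

end

open Matrix in
theorem mainTheorem3 {F : Type*} [Field F] [CharZero F] {n k : ℕ} (hkn : k < n)
    (Φ : Matrix (Fin n) (Fin n) F →ₙ* Matrix (Fin k) (Fin k) F) :
    (Φ 1 = 1 → IsTrivialMulMap Φ) ∧
      ∃ Φbar : F →ₙ* Matrix (Fin k) (Fin k) F,
        ∀ A : Matrix (Fin n) (Fin n) F, Φ A = Φbar A.det := by
  let K := AlgebraicClosure F
  let ε : Matrix (Fin k) (Fin k) F →ₙ* Module.End K (Fin k → K) :=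
    { toFun := fun A => toLin' (A.map (algebraMap F K))
      map_mul' := fun A B => by
        rw [Matrix.map_mul, toLin'_mul]; rfl }
  have hε : Function.Injective ε := fun A B h =>
    Matrix.map_injective (algebraMap F K).injective (toLin'.injective h)
  have htr : ∀ t : TransvectionStruct (Fin n) F, Φ t.toMatrix = Φ 1 := fun t =>
    hε (map_transvection_eq_map_one_of_finrank_lt (by simpa using hkn) (ε.comp Φ) t)
  have hdet := map_eq_map_diagonal_det Φ htr (⟨0, by omega⟩ : Fin n)
  refine ⟨fun h1 A hA => ?_, ⟨⟨fun a => Φ (diagonal (Pi.mulSingle ⟨0, by omega⟩ a)), ?_⟩, hdet⟩⟩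
  · have hA' : A.det = 1 := hA
    have := hdet A
    rw [hA', Pi.mulSingle_one, Pi.one_def, diagonal_one, h1] at this
    exact this
  · intro a b
    rw [← map_mul, diagonal_mul_diagonal, Pi.mulSingle_mul]
    rfl
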